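/- Let $X$ be a continuum, that is, a nonempty compact connected metric space. Let $2^X$ be the space of nonempty closed subsets of $X$ with the Hausdorff metric, and let $C(X)\subset 2^X$ be the subspace of connected sets. An order arc in $C(X)$ is a continuous map $\alpha:[0,1]\to C(X)$ with $\alpha(s)\subsetneq\alpha(t)$ whenever $0\le s<t\le 1$. A set $A\in 2^X$ with $A\neq X$ is a nonblocker (of singletons) of $X$ if for every $x\in X\setminus A$ there is an order arc $\alpha:[0,1]\to C(X)$ such that $\alpha(0)=\{x\}$, $\alpha(1)=X$ and $\alpha(t)\cap A=\emptyset$ for all $t\in[0,1)$. For $a\in X$, let $\pi(a)$ be the intersection of all nonblockers of $X$ that contain $a$ if there are any, and let $\pi(a)=X$ otherwise. Let $B(a)$ be the set of all $x\in X$ such that $\{a\}$ blocks $\{x\}$, that is, such that for every continuous map $\gamma:[0,1]\to 2^X$ with $\gamma(0)=\{x\}$ and $\gamma(1)=X$ there is a $t<1$ with $a\in\gamma(t)$. If $X$ is homogeneous (for all $p,q\in X$ there is a homeomorphism $h:X\to X$ with $h(p)=q$) and $X$ has at least one nonblocker, then $\pi(x)=B(x)$ for every $x\in X$. -/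

import Mathlib

open TopologicalSpace Set

namespace Continua

/-- The hyperspace `2^X` of nonempty closed subsets of a compact metric space `X`, with the Hausdorff
metric. As `X` is compact, these are the nonempty compact subsets of `X`. -/
abbrev Hyp (X : Type*) [MetricSpace X] : Type _ := NonemptyCompacts X

/-- The hyperspace `C(X)` of subcontinua of `X`, as a subspace of `2^X`. -/
abbrev SubCont (X : Type*) [MetricSpace X] : Type _ := {A : Hyp X // IsConnected (A : Set X)}

/-- A space is homogeneous if its homeomorphisms act transitively on its points. -/
def Homogeneous (X : Type*) [TopologicalSpace X] : Prop :=
  ∀ p q : X, ∃ h : X ≃ₜ X, h p = q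

variable {X : Type*} [MetricSpace X]

/-- An order arc in `C(X)`: a continuous, strictly increasing map from `[0,1]` to `C(X)`. -/
def IsOrderArc (α : unitInterval → SubCont X) : Prop :=
  Continuous α ∧ ∀ s t, s < t → ((α s).1 : Set X) ⊂ ((α t).1 : Set X)

/-- The nonblockers of `X`: the sets `A ∈ 2^X`, other than `X`, such that every point `x` outside `A`
is joined to `X` by an order arc in `C(X)` that avoids `A` before time `1`. -/
def nonblockers (X : Type*) [MetricSpace X] : Set (Hyp X) :=
  {A | (A : Set X) ≠ univ ∧ ∀ x : X, x ∉ A →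
    ∃ α : unitInterval → SubCont X, IsOrderArc α ∧
      ((α 0).1 : Set X) = {x} ∧ ((α 1).1 : Set X) = univ ∧
      ∀ t < 1, ((α t).1 : Set X) ∩ A = ∅}

/-- `B` blocks `A`: every path in `2^X` from `A` to `X` meets `B` before time `1`. -/
def Blocks (B A : Hyp X) : Prop :=
  ∀ γ : unitInterval → Hyp X, Continuous γ → γ 0 = A → (γ 1 : Set X) = univ →
    ∃ t < 1, ((γ t : Set X) ∩ B).Nonempty

/-- The blocked set `B(a)`: the points `x` such that `{a}` blocks `{x}`. -/
def blockedSet (a : X) : Set X :=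
  {x | Blocks ({a} : Hyp X) ({x} : Hyp X)}

/-- The nonblockers of `X` that contain `a`. -/
def nonblockersAt (a : X) : Set (Hyp X) :=
  {A | A ∈ nonblockers X ∧ a ∈ A}

open Classical in
/-- `π(a)`: the intersection of all nonblockers that contain `a` if there are any, and `X` if not. -/
noncomputable def minNonblocker (a : X) : Set X :=
  if (nonblockersAt a).Nonempty then ⋂ A ∈ nonblockersAt a, (A : Set X) else univ

end Continua

/-! Blocking reduces to density. Call the union of the continua that contain `y` and miss `S` the
continuum component of `y` off `S`. Then `A ≠ X` is a nonblocker iff every point outside it has a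
dense component off `A` (`mem_nonblockers_iff`), and `x ∈ B(a)` iff the component of `x` off `{a}`
is not dense (`mem_blockedSet_iff`). Hence `B(a) ⊆ π(a)`, and `B(a)`, if closed and proper, is
itself a nonblocker containing `a`, which gives equality.

Closedness of `B(a)` is the crux. `symm_of_homogeneous` makes an invariant preorder with closed
upper sets symmetric. It applies first to `π`; the symmetry of `π` shows that `{a | y ∈ B(a)}` is
closed; so it applies to `B`, and `B(a)` becomes one of these closed sets. -/

namespace Continua

/-! ### Arcs from maximal chains -/

section MaxChain

variable {Y : Type*} [PartialOrder Y]

theorem mem_of_isMaxChain_of_comparable {M : Set Y} (hM : IsMaxChain (· ≤ ·) M) {x : Y}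
    (hx : ∀ m ∈ M, x ≤ m ∨ m ≤ x) : x ∈ M := by
  have h : IsChain (· ≤ ·) (insert x M) := hM.1.insert fun m hm _ => hx m hm
  rw [hM.2 h (subset_insert _ _)]
  exact mem_insert _ _

variable [TopologicalSpace Y] [OrderClosedTopology Y]

theorem isClosed_of_isMaxChain {M : Set Y} (hM : IsMaxChain (· ≤ ·) M) : IsClosed M := by
  refine isClosed_of_closure_subset fun x hx => mem_of_isMaxChain_of_comparable hM fun m hm => ?_
  have hcl : IsClosed {z : Y | z ≤ m ∨ m ≤ z} := isClosed_Iic.union isClosed_Ici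
  exact closure_minimal (fun z hz => hM.1.total hz hm) hcl hx

/-- If `ν` skipped `c` on `M`, compactness would give a last member below `c` and a first above; an
element strictly between them is comparable to all of `M`, against maximality. -/
theorem image_isMaxChain_eq_Icc [BoundedOrder Y] [CompactSpace Y] [DenselyOrdered Y] {ν : Y → ℝ}
    (hν : Continuous ν) (hmono : StrictMono ν) {M : Set Y} (hM : IsMaxChain (· ≤ ·) M) :
    ν '' M = Icc (ν ⊥) (ν ⊤) := by
  apply Subset.antisymm
  · rintro _ ⟨m, -, rfl⟩
    exact ⟨hmono.monotone bot_le, hmono.monotone le_top⟩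
  · rintro c ⟨hc₁, hc₂⟩
    have hcomp : IsCompact M := (isClosed_of_isMaxChain hM).isCompact
    by_contra hc
    obtain ⟨k, ⟨hkM, hkc⟩, hk⟩ := (hcomp.inter_right (isClosed_le hν continuous_const)).exists_isMaxOn
      (s := M ∩ {z | ν z ≤ c}) ⟨⊥, hM.bot_mem, hc₁⟩ hν.continuousOn
    obtain ⟨l, ⟨hlM, hlc⟩, hl⟩ := (hcomp.inter_right (isClosed_le continuous_const hν)).exists_isMinOn
      (s := M ∩ {z | c ≤ ν z}) ⟨⊤, hM.top_mem, hc₂⟩ hν.continuousOn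
    have hkc' : ν k < c := lt_of_le_of_ne hkc fun h => hc ⟨k, hkM, h⟩
    have hlc' : c < ν l := lt_of_le_of_ne hlc fun h => hc ⟨l, hlM, h.symm⟩
    have hkl : k < l := by
      rcases hM.1.total hkM hlM with h | h
      · exact lt_of_le_of_ne h fun h => by subst h; exact lt_asymm hkc' hlc'
      · exact absurd (hmono.monotone h) (not_le.2 (hkc'.trans hlc'))
    obtain ⟨m, hkm, hml⟩ := exists_between hkl
    have hmM : m ∈ M := by
      refine mem_of_isMaxChain_of_comparable hM fun n hn => ?_
      have key : ∀ a ∈ M, ∀ b ∈ M, ν a ≤ ν b → a ≤ b := fun a ha b hb hab => by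
        rcases hM.1.total ha hb with h | h
        · exact h
        · rcases h.eq_or_lt with h | h
          · exact h.ge
          · exact absurd (hmono h) (not_lt.2 hab)
      rcases le_total (ν n) c with h | h
      · exact .inr ((key n hn k hkM (hk ⟨hn, h⟩)).trans hkm.le)
      · exact .inl (hml.le.trans (key l hlM n hn (hl ⟨hn, h⟩)))
    rcases le_total (ν m) c with h | h
    · exact absurd (hmono hkm) (not_lt.2 (hk ⟨hmM, h⟩))
    · exact absurd (hmono hml) (not_lt.2 (hl ⟨hmM, h⟩))

/-- A maximal chain in a compact, densely ordered space with a strictly monotone continuous real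
function is the range of an order arc. -/
theorem exists_arc_of_isMaxChain [BoundedOrder Y] [CompactSpace Y] [DenselyOrdered Y]
    [Nontrivial Y] {ν : Y → ℝ} (hν : Continuous ν) (hmono : StrictMono ν) {M : Set Y}
    (hM : IsMaxChain (· ≤ ·) M) :
    ∃ α : unitInterval → Y, Continuous α ∧ StrictMono α ∧ α 0 = ⊥ ∧ α 1 = ⊤ ∧ ∀ t, α t ∈ M := by
  have himg := image_isMaxChain_eq_Icc hν hmono hM
  have hlt : ν ⊥ < ν ⊤ := hmono bot_lt_top
  have hinj : InjOn ν M := fun a ha b hb hab => by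
    rcases hM.1.total ha hb with h | h
    · exact h.eq_of_not_lt fun h => (hmono h).ne hab
    · exact (h.eq_of_not_lt fun h => (hmono h).ne hab.symm).symm
  have hbij : BijOn ν M (Icc (ν ⊥) (ν ⊤)) := ⟨fun m hm => himg ▸ mem_image_of_mem ν hm, hinj, himg.ge⟩
  have : CompactSpace M := isCompact_iff_compactSpace.1 (isClosed_of_isMaxChain hM).isCompact
  let e : M ≃ Icc (ν ⊥) (ν ⊤) := hbij.equiv ν
  have he : Continuous e := (hν.comp continuous_subtype_val).subtype_mk _
  let E : M ≃ₜ Icc (ν ⊥) (ν ⊤) := he.homeoOfEquivCompactToT2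
  let F : M ≃ₜ unitInterval := E.trans (iccHomeoI _ _ hlt)
  have hE : ∀ m : M, ν (m : Y) = (ν ⊤ - ν ⊥) * F m + ν ⊥ := fun m => by
    have := congrArg Subtype.val ((iccHomeoI _ _ hlt).symm_apply_apply (E m))
    rw [iccHomeoI_symm_apply_coe] at this
    exact this.symm
  have hval : ∀ t, ν (F.symm t : Y) = (ν ⊤ - ν ⊥) * t + ν ⊥ := fun t => by
    rw [hE, F.apply_symm_apply]
  refine ⟨fun t => F.symm t, continuous_subtype_val.comp F.symm.continuous, fun s t hst => ?_, ?_, ?_,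
    fun t => (F.symm t).2⟩
  · have hs : ν (F.symm s : Y) < ν (F.symm t : Y) := by
      rw [hval, hval]
      have : (s : ℝ) < t := hst
      nlinarith
    rcases hM.1.total (F.symm s).2 (F.symm t).2 with h | h
    · exact lt_of_le_of_ne h fun h => hs.ne (congrArg ν h)
    · exact absurd (hmono.monotone h) (not_le.2 hs)
  · exact hinj (F.symm 0).2 hM.bot_mem (by rw [hval]; simp)
  · exact hinj (F.symm 1).2 hM.top_mem (by rw [hval]; simp)

end MaxChain

/-! ### The hyperspace, boundary bumping and a Whitney map -/

variable {X : Type*} [MetricSpace X]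

theorem isClosed_setOf_isConnected : IsClosed {K : Hyp X | IsConnected (K : Set X)} := by
  rw [← isOpen_compl_iff, isOpen_iff_mem_nhds]
  intro K hK
  have hK' : ¬ IsPreconnected (K : Set X) := fun h => hK ⟨K.nonempty, h⟩
  rw [isPreconnected_iff_subset_of_fully_disjoint_closed K.isCompact.isClosed] at hK'
  push Not at hK'
  obtain ⟨u, v, hu, hv, huv, hd, hnu, hnv⟩ := hK'
  obtain ⟨U, V, hU, hV, huU, hvV, hUV⟩ := normal_separation hu hv hd
  have h1 := (NonemptyCompacts.isOpen_subsets_of_isOpen (hU.union hV)).mem_nhds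
    (show K ∈ _ from huv.trans (union_subset_union huU hvV))
  have h2 := (NonemptyCompacts.isOpen_inter_nonempty_of_isOpen hU).mem_nhds (show K ∈ _ by
    obtain ⟨x, hx, hxv⟩ := not_subset.1 hnv
    exact ⟨x, hx, huU ((huv hx).resolve_right hxv)⟩)
  have h3 := (NonemptyCompacts.isOpen_inter_nonempty_of_isOpen hV).mem_nhds (show K ∈ _ by
    obtain ⟨x, hx, hxu⟩ := not_subset.1 hnu
    exact ⟨x, hx, hvV ((huv hx).resolve_left hxu)⟩)
  filter_upwards [h1, h2, h3] with L hL1 hL2 hL3 hL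
  obtain ⟨x, -, hxU, hxV⟩ := hL.2 U V hU hV hL1 hL2 hL3
  exact hUV.le_bot ⟨hxU, hxV⟩

instance : OrderClosedTopology (Hyp X) where
  isClosed_le' := by
    have : {p : Hyp X × Hyp X | p.1 ≤ p.2} = {p | p.1 ⊔ p.2 = p.2} := by ext p; simp
    rw [this]
    exact isClosed_eq (continuous_fst.sup continuous_snd) continuous_snd

/-- Boundary bumping: a proper subcontinuum `K` of a continuum `L` is not maximal among the proper
subcontinua of `L`. -/
theorem exists_connected_between {K L : Set X} (hK : IsCompact K) (hKc : IsConnected K)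
    (hL : IsCompact L) (hLc : IsConnected L) (hKL : K ⊂ L) :
    ∃ M, IsCompact M ∧ IsConnected M ∧ K ⊂ M ∧ M ⊂ L := by
  obtain ⟨p, hpL, hpK⟩ := exists_of_ssubset hKL
  obtain ⟨k, hk⟩ := hKc.nonempty
  obtain ⟨U, V, hU, hV, hKU, hpV, hUV⟩ := normal_separation hK.isClosed
    (isClosed_singleton (x := p)) (disjoint_singleton_right.2 hpK)
  have hpV : p ∈ V := hpV rfl
  set W : Set X := L \ V with hW
  have hWc : IsCompact W := hL.diff hV
  have hKW : K ⊆ W := fun x hx => ⟨hKL.1 hx, fun hxV => hUV.le_bot ⟨hKU hx, hxV⟩⟩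
  have hUW : U ∩ L ⊆ W := fun x hx => ⟨hx.2, fun hxV => hUV.le_bot ⟨hx.1, hxV⟩⟩
  have hMW := connectedComponentIn_subset W k
  have hKM : K ⊆ connectedComponentIn W k := hKc.2.subset_connectedComponentIn hk hKW
  have : CompactSpace W := isCompact_iff_compactSpace.1 hWc
  have hMc : IsCompact (connectedComponentIn W k) := by
    rw [connectedComponentIn_eq_image (hKW hk)]
    exact isClosed_connectedComponent.isCompact.image continuous_subtype_val
  refine ⟨_, hMc, isConnected_connectedComponentIn_iff.2 (hKW hk), ⟨hKM, fun hMK => ?_⟩,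
    hMW.trans sdiff_subset, fun h => (hMW (h hpL)).2 hpV⟩
  let w : W := ⟨k, hKW hk⟩
  have hcc : connectedComponent w ⊆ ((↑) : W → X) ⁻¹' U := by
    intro x hx
    refine hKU (hMK ?_)
    rw [connectedComponentIn_eq_image (hKW hk)]
    exact ⟨x, hx, rfl⟩
  -- In the compact space `W` a component is the intersection of clopen sets, so some clopen `Z`
  -- lies in `U`. As `U ∩ L ⊆ W`, it is clopen in `L` too and would disconnect `L`.
  rw [connectedComponent_eq_iInter_isClopen] at hcc
  have : Nonempty {s : Set W // IsClopen s ∧ w ∈ s} := ⟨⟨univ, isClopen_univ, mem_univ _⟩⟩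
  obtain ⟨⟨Z, hZ, hwZ⟩, hZU⟩ := exists_subset_nhds_of_isCompact
    (V := fun s : {s : Set W // IsClopen s ∧ w ∈ s} => (s : Set W))
    (fun s t => ⟨⟨s.1 ∩ t.1, s.2.1.inter t.2.1, s.2.2, t.2.2⟩, inter_subset_left, inter_subset_right⟩)
    (fun s => s.2.1.isClosed.isCompact)
    (fun x hx => (hU.preimage continuous_subtype_val).mem_nhds (hcc hx))
  obtain ⟨O, hO, hOZ⟩ := isOpen_induced_iff.1 hZ.isOpen
  have hF : IsClosed (((↑) : W → X) '' Z) :=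
    (hZ.isClosed.isCompact.image continuous_subtype_val).isClosed
  have hLs : L ⊆ (O ∩ U) ∪ (((↑) : W → X) '' Z)ᶜ := by
    intro x hx
    by_cases hxZ : x ∈ ((↑) : W → X) '' Z
    · obtain ⟨z, hz, rfl⟩ := hxZ
      exact .inl ⟨by rw [← hOZ] at hz; exact hz, hZU hz⟩
    · exact .inr hxZ
  obtain ⟨x, hxL, hxO, hxZ⟩ := hLc.2 _ _ (hO.inter hU) hF.isOpen_compl hLs
    ⟨k, hKL.1 hk, by rw [← hOZ] at hwZ; exact hwZ, hKU hk⟩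
    ⟨p, hpL, by rintro ⟨z, -, hz⟩; exact z.2.2 (hz ▸ hpV)⟩
  exact hxZ ⟨⟨x, hUW ⟨hxO.2, hxL⟩⟩, by rw [← hOZ]; exact hxO.1, rfl⟩

/-- A real function on the hyperspace that is continuous and strictly increasing. -/
noncomputable def whitney [CompactSpace X] [Nonempty X] (K : Hyp X) : ℝ :=
  -∑' n : ℕ, (1 / 2 : ℝ) ^ n * min 1 (Metric.infDist (denseSeq X n) (K : Set X))

section Whitney

variable [CompactSpace X] [Nonempty X]

theorem whitney_term_le (n : ℕ) (K : Hyp X) :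
    ‖(1 / 2 : ℝ) ^ n * min 1 (Metric.infDist (denseSeq X n) (K : Set X))‖ ≤ (1 / 2 : ℝ) ^ n := by
  have h0 : 0 ≤ min 1 (Metric.infDist (denseSeq X n) (K : Set X)) :=
    le_min zero_le_one Metric.infDist_nonneg
  rw [Real.norm_of_nonneg (by positivity)]
  exact mul_le_of_le_one_right (by positivity) (min_le_left _ _)

theorem continuous_whitney : Continuous (whitney (X := X)) := by
  refine (continuous_tsum (fun n => ?_) summable_geometric_two whitney_term_le).neg
  exact continuous_const.mul (continuous_const.min (Metric.lipschitz_infDist_set _).continuous)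

theorem strictMono_whitney : StrictMono (whitney (X := X)) := by
  intro K L hKL
  have hsum : ∀ K : Hyp X, Summable fun n : ℕ =>
      (1 / 2 : ℝ) ^ n * min 1 (Metric.infDist (denseSeq X n) (K : Set X)) := fun K =>
    .of_norm_bounded summable_geometric_two (whitney_term_le · K)
  obtain ⟨p, hpL, hpK⟩ := SetLike.exists_of_lt hKL
  have hr : 0 < Metric.infDist p (K : Set X) :=
    (K.isCompact.isClosed.notMem_iff_infDist_pos K.nonempty).1 hpK
  -- The half radius puts this point nearer to `L` than to `K`; the bound 1/2 keeps the truncation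
  -- at 1 from hiding that.
  obtain ⟨n, hn⟩ := (denseRange_denseSeq X).exists_dist_lt p
    (lt_min (half_pos hr) one_half_pos)
  rw [lt_min_iff] at hn
  have hnL : Metric.infDist (denseSeq X n) (L : Set X) ≤ dist p (denseSeq X n) := by
    rw [dist_comm]; exact Metric.infDist_le_dist_of_mem hpL
  have hnK := Metric.infDist_le_infDist_add_dist (s := (K : Set X)) (x := p) (y := denseSeq X n)
  refine neg_lt_neg ((hsum L).tsum_lt_tsum (i := n) (fun m => ?_) ?_ (hsum K))
  · exact mul_le_mul_of_nonneg_left (min_le_min_left _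
      (Metric.infDist_le_infDist_of_subset hKL.le K.nonempty)) (by positivity)
  · refine mul_lt_mul_of_pos_left ?_ (by positivity)
    rw [min_eq_right (by linarith)]
    exact lt_min (by linarith) (by linarith)

end Whitney

/-- The subcontinua of `X` that contain `y`. -/
abbrev SubContAt (y : X) : Type _ := {K : Hyp X // IsConnected (K : Set X) ∧ y ∈ K}

/-! ### Order arcs through a chain of continua -/

section SubContAt

variable (y : X)

theorem isClosed_subContAt : IsClosed {K : Hyp X | IsConnected (K : Set X) ∧ y ∈ K} := by
  have h := NonemptyCompacts.isClosed_inter_nonempty_of_isClosed (isClosed_singleton (x := y))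
  simp only [inter_singleton_nonempty, SetLike.mem_coe] at h
  exact isClosed_setOf_isConnected.inter h

instance [CompactSpace X] : CompactSpace (SubContAt y) :=
  isCompact_iff_compactSpace.1 (isClosed_subContAt y).isCompact

instance [CompactSpace X] [ConnectedSpace X] : BoundedOrder (SubContAt y) where
  bot := ⟨{y}, by simpa using isConnected_singleton, by simp⟩
  bot_le K := show (({y} : Hyp X) : Set X) ⊆ _ by simpa using K.2.2
  top := ⟨⊤, by simpa using isConnected_univ, mem_univ y⟩
  le_top K := show ((K : Hyp X) : Set X) ⊆ _ by simp

instance [Nontrivial X] [CompactSpace X] [ConnectedSpace X] : Nontrivial (SubContAt y) := by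
  refine ⟨⊥, ⊤, fun h => ?_⟩
  obtain ⟨x, hx⟩ := exists_ne y
  have : x ∈ ((⊤ : SubContAt y) : Hyp X) := mem_univ x
  rw [← h] at this
  exact hx this

instance : DenselyOrdered (SubContAt y) where
  dense K L hKL := by
    obtain ⟨M, hM, hMc, hKM, hML⟩ := exists_connected_between K.1.isCompact K.2.1 L.1.isCompact L.2.1
      (show (K.1 : Set X) ⊂ L.1 from hKL)
    exact ⟨⟨⟨⟨M, hM⟩, hMc.nonempty⟩, hMc, hKM.1 K.2.2⟩, hKM, hML⟩

/-- Every chain of subcontinua containing `y` is refined by an order arc from `{y}` to `X`. -/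
theorem exists_arc_comparable_of_isChain [Nontrivial X] [CompactSpace X] [ConnectedSpace X]
    {C : Set (SubContAt y)} (hC : IsChain (· ≤ ·) C) :
    ∃ α : unitInterval → SubContAt y, Continuous α ∧ StrictMono α ∧ α 0 = ⊥ ∧ α 1 = ⊤ ∧
      ∀ t, ∀ K ∈ C, α t ≤ K ∨ K ≤ α t := by
  obtain ⟨M, hM, hCM⟩ := hC.exists_maxChain
  obtain ⟨α, hα, hmono, h0, h1, hαM⟩ := exists_arc_of_isMaxChain
    (ν := fun K : SubContAt y => whitney (K : Hyp X)) (continuous_whitney.comp continuous_subtype_val)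
    (fun K L hKL => strictMono_whitney hKL) hM
  exact ⟨α, hα, hmono, h0, h1, fun t K hK => hM.1.total (hαM t) (hCM hK)⟩

end SubContAt

/-- The union of all continua that contain `y` and are disjoint from `S`. -/
def continuumComponent (S : Set X) (y : X) : Set X :=
  {z | ∃ K, IsCompact K ∧ IsConnected K ∧ y ∈ K ∧ z ∈ K ∧ Disjoint K S}

/-! ### Continuum components and density -/

section ContinuumComponent

variable {S T : Set X} {y z w : X}

theorem notMem_of_mem_continuumComponent (h : z ∈ continuumComponent S y) : z ∉ S :=
  let ⟨_, _, _, _, hz, hd⟩ := h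
  disjoint_left.1 hd hz

theorem continuumComponent_symm (h : z ∈ continuumComponent S y) : y ∈ continuumComponent S z :=
  let ⟨K, hK, hc, hy, hz, hd⟩ := h
  ⟨K, hK, hc, hz, hy, hd⟩

theorem continuumComponent_trans (h : z ∈ continuumComponent S y)
    (h' : w ∈ continuumComponent S z) : w ∈ continuumComponent S y :=
  let ⟨K, hK, hc, hy, hz, hd⟩ := h
  let ⟨L, hL, hc', hz', hw, hd'⟩ := h'
  ⟨K ∪ L, hK.union hL, hc.union ⟨z, hz, hz'⟩ hc', .inl hy, .inr hw, hd.union_left hd'⟩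

theorem continuumComponent_subset_of_mem (h : z ∈ continuumComponent S y) :
    continuumComponent S z ⊆ continuumComponent S y :=
  fun _ => continuumComponent_trans h

theorem continuumComponent_anti (h : S ⊆ T) :
    continuumComponent T y ⊆ continuumComponent S y :=
  fun _ ⟨K, hK, hc, hy, hz, hd⟩ => ⟨K, hK, hc, hy, hz, hd.mono_right h⟩

theorem image_continuumComponent_subset (h : X ≃ₜ X) (S : Set X) (y : X) :
    h '' continuumComponent S y ⊆ continuumComponent (h '' S) (h y) := by
  rintro _ ⟨z, ⟨K, hK, hc, hy, hz, hd⟩, rfl⟩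
  exact ⟨h '' K, hK.image h.continuous, hc.image h h.continuous.continuousOn,
    mem_image_of_mem h hy, mem_image_of_mem h hz, (disjoint_image_iff h.injective).2 hd⟩

theorem dense_continuumComponent_image (h : X ≃ₜ X) (hd : Dense (continuumComponent S y)) :
    Dense (continuumComponent (h '' S) (h y)) :=
  (h.surjective.denseRange.dense_image h.continuous hd).mono
    (image_continuumComponent_subset h S y)

/-- A set is dense if it contains all but the last member of a path of closed sets that ends at the
whole space. -/
theorem dense_of_path {D : Set X} {γ : unitInterval → Hyp X} (hγ : Continuous γ)
    (h1 : (γ 1 : Set X) = univ) (hD : ∀ t < 1, (γ t : Set X) ⊆ D) : Dense D := by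
  have hcl : IsClosed {t | (γ t : Set X) ⊆ closure D} :=
    (NonemptyCompacts.isClosed_subsets_of_isClosed isClosed_closure).preimage hγ
  have hmem : (1 : unitInterval) ∈ closure (Iio 1) := by
    rw [closure_Iio' ⟨0, zero_lt_one⟩]
    exact self_mem_Iic
  have : (γ 1 : Set X) ⊆ closure D :=
    closure_minimal (fun t ht => (hD t ht).trans subset_closure) hcl hmem
  rw [h1] at this
  exact fun x => this (mem_univ x)

/-- A path of closed sets that starts at `{y}` and avoids `S` before time `1` stays in the continuum
component of `y`. -/
theorem subset_continuumComponent_of_path {γ : unitInterval → Hyp X} (hγ : Continuous γ)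
    (h0 : (γ 0 : Set X) = {y}) (hS : ∀ t < 1, Disjoint (γ t : Set X) S) :
    ∀ t < 1, (γ t : Set X) ⊆ continuumComponent S y := by
  intro t ht z hz
  have h0t : (0 : unitInterval) ∈ Iic t := t.2.1
  have hcov : ∀ s ∈ Iic t, (γ s : Set X) ⊆ ⋃ s ∈ Iic t, (γ s : Set X) :=
    fun s hs => subset_biUnion_of_mem (u := fun s => (γ s : Set X)) hs
  have hy : y ∈ ⋃ s ∈ Iic t, (γ s : Set X) := hcov 0 h0t (h0 ▸ rfl)
  refine ⟨⋃ s ∈ Iic t, (γ s : Set X), ?_, ⟨⟨y, hy⟩, ?_⟩, hy, hcov t self_mem_Iic hz, ?_⟩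
  · have := NonemptyCompacts.isCompact_biUnion_coe_of_isCompact
      ((isClosed_Iic (a := t)).isCompact.image hγ)
    rwa [biUnion_image] at this
  · rw [← sUnion_image]
    -- The members of a path need not be connected: a Vietoris-connected family with one connected
    -- member, here `{y}`, has connected union.
    refine vietoris.isPreconnected_sUnion (s := (fun s => (γ s : Set X)) '' Iic t) ?_
      ⟨_, ⟨0, h0t, h0⟩, isPreconnected_singleton⟩
    let : TopologicalSpace (Set X) := .vietoris X
    exact ordConnected_Iic.isPreconnected.image _
      (NonemptyCompacts.continuous_coe.comp hγ).continuousOn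
  · simp only [disjoint_iUnion_left]
    exact fun s hs => hS s (lt_of_le_of_lt hs ht)

variable [CompactSpace X] [ConnectedSpace X]

/-- Countably many points are dense in the component; finite unions of the continua joining them to
`y` form the chain. -/
theorem exists_monotone_of_dense (hd : Dense (continuumComponent S y)) :
    ∃ K : ℕ → SubContAt y, Monotone K ∧ (∀ n, Disjoint ((K n : Hyp X) : Set X) S) ∧
      Dense (⋃ n, ((K n : Hyp X) : Set X)) := by
  have : Nonempty (continuumComponent S y) := hd.nonempty.to_subtype
  choose L hL hc hy hz hdis using fun n => (denseSeq (continuumComponent S y) n).2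
  have hyn : ∀ n, y ∈ accumulate L n := fun n => subset_accumulate (hy n)
  have hconn : ∀ n, IsConnected (accumulate L n) := fun n => ⟨⟨y, hyn n⟩, by
    have : accumulate L n = ⋃₀ (L '' Iic n) := by
      rw [sUnion_image]; rfl
    rw [this]
    exact isPreconnected_sUnion y _ (forall_mem_image.2 fun m _ => hy m)
      (forall_mem_image.2 fun m _ => (hc m).2)⟩
  refine ⟨fun n => ⟨⟨⟨accumulate L n, isCompact_accumulate hL n⟩, ⟨y, hyn n⟩⟩, hconn n, hyn n⟩,
    fun m n hmn => monotone_accumulate hmn, fun n => ?_, ?_⟩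
  · change Disjoint (accumulate L n) S
    simp only [accumulate_def, disjoint_iUnion_left]
    exact fun m _ => hdis m
  · refine Dense.mono ?_ (hd.denseRange_val.comp (denseRange_denseSeq _) continuous_subtype_val)
    rintro _ ⟨n, rfl⟩
    exact mem_iUnion.2 ⟨n, subset_accumulate (hz n)⟩

/-- If the continuum component of `y` off `S` is dense, then an order arc from `{y}` to `X` avoids
`S` before its end. -/
theorem exists_arc_of_dense [Nontrivial X] (hd : Dense (continuumComponent S y)) :
    ∃ α : unitInterval → SubContAt y, Continuous α ∧ StrictMono α ∧ α 0 = ⊥ ∧ α 1 = ⊤ ∧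
      ∀ t < 1, Disjoint ((α t : Hyp X) : Set X) S := by
  obtain ⟨K, hK, hdis, hdense⟩ := exists_monotone_of_dense hd
  obtain ⟨α, hα, hmono, h0, h1, hcomp⟩ := exists_arc_comparable_of_isChain y hK.isChain_range
  refine ⟨α, hα, hmono, h0, h1, fun t ht => ?_⟩
  -- Either `α t` lies in some `K n` and misses `S`, or it contains them all and, being closed, is
  -- `X`, which forces `t = 1`.
  by_cases h : ∃ n, α t ≤ K n
  · obtain ⟨n, hn⟩ := h
    exact (hdis n).mono_left hn
  · push Not at h
    have hle : ∀ n, K n ≤ α t := fun n => (hcomp t _ ⟨n, rfl⟩).resolve_left (h n)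
    have htop : ⊤ ≤ α t := by
      intro x _
      exact closure_minimal (iUnion_subset hle) (α t).1.isCompact.isClosed (hdense x)
    exact absurd (hmono ht) (not_lt_of_ge (h1 ▸ htop))

theorem mem_nonblockers_iff {A : Hyp X} : A ∈ nonblockers X ↔
    (A : Set X) ≠ univ ∧ ∀ x ∉ A, Dense (continuumComponent (A : Set X) x) := by
  refine and_congr_right fun hA => forall₂_congr fun x hx => ⟨?_, fun hd => ?_⟩
  · rintro ⟨α, hα, h0, h1, hdis⟩
    have hγ : Continuous fun t => (α t).1 := continuous_subtype_val.comp hα.1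
    exact dense_of_path hγ h1 (subset_continuumComponent_of_path hγ h0 fun t ht =>
      disjoint_iff_inter_eq_empty.2 (hdis t ht))
  · obtain ⟨a, ha⟩ := A.nonempty
    have : Nontrivial X := ⟨x, a, fun h => hx (h ▸ ha)⟩
    obtain ⟨α, hα, hmono, h0, h1, hdis⟩ := exists_arc_of_dense hd
    refine ⟨fun t => ⟨(α t).1, (α t).2.1⟩, ⟨(continuous_subtype_val.comp hα).subtype_mk _,
      fun s t hst => hmono hst⟩, ?_, ?_, fun t ht => (hdis t ht).inter_eq⟩
    · simp only [h0]; rfl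
    · simp only [h1]; rfl

theorem mem_blockedSet_iff [Nontrivial X] {a x : X} :
    x ∈ blockedSet a ↔ ¬ Dense (continuumComponent {a} x) := by
  constructor
  · intro hb hd
    obtain ⟨α, hα, -, h0, h1, hdis⟩ := exists_arc_of_dense hd
    obtain ⟨t, ht, hne⟩ := hb (fun t => (α t).1) (continuous_subtype_val.comp hα)
      (by simp only [h0]; rfl) (by simp only [h1]; rfl)
    rw [NonemptyCompacts.coe_singleton, ← not_disjoint_iff_nonempty_inter] at hne
    exact hne (hdis t ht)
  · intro hd γ hγ h0 h1
    by_contra! hdis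
    exact hd (dense_of_path hγ h1 (subset_continuumComponent_of_path hγ (by simp [h0]) fun t ht => by
      have := hdis t ht
      rwa [NonemptyCompacts.coe_singleton, ← disjoint_iff_inter_eq_empty] at this))

end ContinuumComponent

/-- On a compact homogeneous space, an invariant preorder with closed upper sets is symmetric. -/
theorem symm_of_homogeneous {X : Type*} [TopologicalSpace X] [CompactSpace X]
    (hom : Homogeneous X) {R : X → X → Prop} (hrefl : ∀ x, R x x)
    (htrans : ∀ x y z, R x y → R y z → R x z) (hcl : ∀ x, IsClosed {y | R x y})
    (hinv : ∀ (h : X ≃ₜ X) x y, R x y → R (h x) (h y)) {x y : X} (hxy : R x y) : R y x := by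
  obtain ⟨U, hU⟩ : ∃ U, Minimal (· ∈ range fun x => {y | R x y}) U := by
    obtain ⟨m, -, hm⟩ := zorn_superset_nonempty (range fun x => {y | R x y}) (fun c hc hchain hne => by
      have := hne.to_subtype
      obtain ⟨z, hz⟩ := IsCompact.nonempty_sInter_of_directed_nonempty_isCompact_isClosed
        (S := c) (fun u hu v hv => (hchain.total hu hv).elim
          (fun h => ⟨u, hu, Subset.rfl, h⟩) fun h => ⟨v, hv, h, Subset.rfl⟩) (fun u hu => by
          obtain ⟨w, rfl⟩ := hc hu; exact ⟨w, hrefl w⟩)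
        (fun u hu => by obtain ⟨w, rfl⟩ := hc hu; exact (hcl w).isCompact)
        (fun u hu => by obtain ⟨w, rfl⟩ := hc hu; exact hcl w)
      refine ⟨_, ⟨z, rfl⟩, fun u hu v hv => ?_⟩
      have hzu := hz u hu
      obtain ⟨w, rfl⟩ := hc hu
      exact htrans _ _ _ hzu hv) _ ⟨x, rfl⟩
    exact ⟨m, hm⟩
  obtain ⟨⟨c, rfl⟩, hmin⟩ := hU
  -- One minimal upper set suffices: a homeomorphism carries the question from `x` to `c`.
  obtain ⟨h, rfl⟩ := hom c x
  have hcy : R c (h.symm y) := by simpa using hinv h.symm _ _ hxy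
  have hyc : R (h.symm y) c :=
    hmin ⟨h.symm y, rfl⟩ (fun z hz => htrans _ _ _ hcy hz) (hrefl c)
  simpa using hinv h _ _ hyc

theorem self_mem_blockedSet (a : X) : a ∈ blockedSet a := fun γ _ h0 _ =>
  ⟨0, zero_lt_one, by rw [h0]; exact ⟨a, rfl, rfl⟩⟩

theorem mem_minNonblocker_iff {a x : X} (hne : (nonblockersAt a).Nonempty) :
    x ∈ minNonblocker a ↔ ∀ A ∈ nonblockers X, a ∈ A → x ∈ A := by
  rw [minNonblocker, if_pos hne]
  simp [nonblockersAt]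

theorem isClosed_minNonblocker (a : X) : IsClosed (minNonblocker a) := by
  unfold minNonblocker
  split_ifs
  · exact isClosed_biInter fun A _ => A.isCompact.isClosed
  · exact isClosed_univ

theorem minNonblocker_ne_univ {a : X} (hne : (nonblockersAt a).Nonempty) :
    minNonblocker a ≠ univ := by
  obtain ⟨A, hA, ha⟩ := hne
  refine fun h => hA.1 (eq_univ_of_forall fun x => ?_)
  exact (mem_minNonblocker_iff ⟨A, hA, ha⟩).1 (h ▸ mem_univ x) A hA ha

variable [CompactSpace X] [ConnectedSpace X]

/-! ### The sets `B(a)` -/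

section Blocked

theorem blockedSet_subset {a : X} {A : Hyp X} (hA : A ∈ nonblockers X) (ha : a ∈ A) :
    blockedSet a ⊆ A := by
  intro x hx
  by_contra hxA
  have : Nontrivial X := ⟨x, a, fun h => hxA (h ▸ ha)⟩
  exact mem_blockedSet_iff.1 hx (((mem_nonblockers_iff.1 hA).2 x hxA).mono
    (continuumComponent_anti (singleton_subset_iff.2 ha)))

variable [Nontrivial X]

theorem blockedSet_trans {x a b : X} (hxa : x ∈ blockedSet a) (hab : a ∈ blockedSet b) :
    x ∈ blockedSet b := by
  rw [mem_blockedSet_iff] at *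
  intro hd
  by_cases ha : a ∈ continuumComponent {b} x
  · exact hab (hd.mono (continuumComponent_subset_of_mem (continuumComponent_symm ha)))
  · refine hxa (hd.mono ?_)
    rintro z ⟨K, hK, hc, hx, hz, hdis⟩
    refine ⟨K, hK, hc, hx, hz, ?_⟩
    exact disjoint_singleton_right.2 fun haK => ha ⟨K, hK, hc, hx, haK, hdis⟩

theorem image_mem_blockedSet (h : X ≃ₜ X) {x a : X} (hx : x ∈ blockedSet a) :
    h x ∈ blockedSet (h a) := by
  rw [mem_blockedSet_iff] at *
  intro hd
  have := dense_continuumComponent_image h.symm hd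
  simp only [image_singleton, Homeomorph.symm_apply_apply] at this
  exact hx this

/-- Off `{a}` components are equivalence classes, so one dense component consists of unblocked
points only. -/
theorem disjoint_continuumComponent_blockedSet {a y : X} (hy : y ∉ blockedSet a) :
    Disjoint (continuumComponent {a} y) (blockedSet a) := by
  rw [mem_blockedSet_iff, not_not] at hy
  refine disjoint_left.2 fun z hz hza => mem_blockedSet_iff.1 hza (hy.mono ?_)
  exact continuumComponent_subset_of_mem (continuumComponent_symm hz)

/-- If `B(a)` is closed and not all of `X`, then it is a nonblocker. -/
theorem mem_nonblockers_of_isClosed_blockedSet {a : X} {A : Hyp X}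
    (hA : (A : Set X) = blockedSet a) (hne : blockedSet a ≠ univ) : A ∈ nonblockers X := by
  refine mem_nonblockers_iff.2 ⟨hA ▸ hne, fun y hy => ?_⟩
  have hy : y ∉ blockedSet a := fun h => hy (show y ∈ (A : Set X) from hA ▸ h)
  have hdis := disjoint_continuumComponent_blockedSet hy
  rw [mem_blockedSet_iff, not_not] at hy
  refine hy.mono ?_
  rintro z ⟨K, hK, hc, hyK, hz, hd⟩
  refine ⟨K, hK, hc, hyK, hz, ?_⟩
  rw [hA]
  refine hdis.mono_left ?_
  exact fun w hw => ⟨K, hK, hc, hyK, hw, hd⟩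

end Blocked

/-! ### The sets `π(a)` and closedness of `B(a)` -/

section MinNonblocker

theorem map_mem_nonblockers (h : X ≃ₜ X) {A : Hyp X} (hA : A ∈ nonblockers X) :
    A.map h h.continuous ∈ nonblockers X := by
  obtain ⟨hne, hA⟩ := mem_nonblockers_iff.1 hA
  refine mem_nonblockers_iff.2 ⟨fun heq => hne ?_, fun x hx => ?_⟩
  · rw [NonemptyCompacts.coe_map] at heq
    rw [← h.preimage_image A, heq, preimage_univ]
  · obtain ⟨w, rfl⟩ := h.surjective x
    rw [NonemptyCompacts.coe_map]
    exact dense_continuumComponent_image h (hA w fun hw => hx (mem_image_of_mem h hw))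

/-- Rules out the default value `univ` of `π`. -/
theorem nonblockersAt_nonempty (hom : Homogeneous X) (hne : (nonblockers X).Nonempty) (a : X) :
    (nonblockersAt a).Nonempty := by
  obtain ⟨A, hA⟩ := hne
  obtain ⟨b, hb⟩ := A.nonempty
  obtain ⟨h, rfl⟩ := hom b a
  exact ⟨_, map_mem_nonblockers h hA, mem_image_of_mem h hb⟩

theorem dense_continuumComponent_minNonblocker {a x : X} (hne : (nonblockersAt a).Nonempty)
    (hx : x ∉ minNonblocker a) : Dense (continuumComponent (minNonblocker a) x) := by
  rw [mem_minNonblocker_iff hne] at hx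
  push Not at hx
  obtain ⟨A, hA, ha, hxA⟩ := hx
  refine ((mem_nonblockers_iff.1 hA).2 x hxA).mono (continuumComponent_anti fun z hz => ?_)
  exact (mem_minNonblocker_iff hne).1 hz A hA ha

theorem blockedSet_subset_minNonblocker (a : X) : blockedSet a ⊆ minNonblocker a := by
  by_cases hne : (nonblockersAt a).Nonempty
  · exact fun x hx => (mem_minNonblocker_iff hne).2 fun A hA ha => blockedSet_subset hA ha hx
  · simp [minNonblocker, if_neg hne]

theorem minNonblocker_symm (hom : Homogeneous X) (hne : (nonblockers X).Nonempty) {a b : X}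
    (h : b ∈ minNonblocker a) : a ∈ minNonblocker b := by
  have hn := nonblockersAt_nonempty hom hne
  refine symm_of_homogeneous hom (R := fun a b => b ∈ minNonblocker a) ?_ ?_
    isClosed_minNonblocker ?_ h
  · exact fun x => (mem_minNonblocker_iff (hn x)).2 fun A _ hx => hx
  · simp only [mem_minNonblocker_iff (hn _)]
    exact fun x y z hxy hyz A hA hx => hyz A hA (hxy A hA hx)
  · simp only [mem_minNonblocker_iff (hn _)]
    intro e x y hxy A hA hx
    have := hxy _ (map_mem_nonblockers e.symm hA) ⟨e x, hx, e.symm_apply_apply x⟩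
    obtain ⟨w, hw, hwy⟩ := this
    have : w = e y := by rw [← hwy]; simp
    exact this ▸ hw

variable [Nontrivial X]

/-- If `a` does not block `y`, some continuum `K` missing `a` joins `y` to a point `z ∉ π(y)`.
Suppose `b ∉ K` blocks `y`. Then `y ∈ π(b)`, so `b ∈ π(y)` by symmetry, and the dense component of
`z` off `π(y)` misses `b`. Through `K` it makes the component of `y` off `{b}` dense, a
contradiction. -/
theorem isClosed_setOf_mem_blockedSet (hom : Homogeneous X) (hne : (nonblockers X).Nonempty)
    (y : X) : IsClosed {a | y ∈ blockedSet a} := by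
  have hn := nonblockersAt_nonempty hom hne
  rw [← isOpen_compl_iff, isOpen_iff_mem_nhds]
  intro a ha
  have hd : Dense (continuumComponent {a} y) := by
    by_contra hd; exact ha (mem_blockedSet_iff.2 hd)
  obtain ⟨z, ⟨K, hK, hc, hyK, hzK, hdis⟩, hzP⟩ : ∃ z ∈ continuumComponent {a} y,
      z ∉ minNonblocker y := by
    by_contra! h
    exact minNonblocker_ne_univ (hn y)
      (univ_subset_iff.1 fun x _ => closure_minimal h (isClosed_minNonblocker y) (hd x))
  filter_upwards [hK.isClosed.isOpen_compl.mem_nhds (disjoint_singleton_right.1 hdis)]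
    with b hbK hb
  have hbP := minNonblocker_symm hom hne (blockedSet_subset_minNonblocker b hb)
  refine mem_blockedSet_iff.1 hb ((dense_continuumComponent_minNonblocker (hn y) hzP).mono ?_)
  exact (continuumComponent_anti (singleton_subset_iff.2 hbP)).trans
    (continuumComponent_subset_of_mem ⟨K, hK, hc, hyK, hzK, disjoint_singleton_right.2 hbK⟩)

theorem isClosed_blockedSet (hom : Homogeneous X) (hne : (nonblockers X).Nonempty) (a : X) :
    IsClosed (blockedSet a) := by
  have hcl := isClosed_setOf_mem_blockedSet hom hne
  have hsymm : ∀ {x y : X}, x ∈ blockedSet y → y ∈ blockedSet x := fun {x y} h =>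
    symm_of_homogeneous hom (R := fun x y => x ∈ blockedSet y) self_mem_blockedSet
      (fun _ _ _ => blockedSet_trans) hcl (fun h _ _ => image_mem_blockedSet h) h
  convert hcl a using 1
  exact Set.ext fun x => ⟨hsymm, hsymm⟩

end MinNonblocker

end Continua

theorem mainTheorem6 {X : Type*} [MetricSpace X] [CompactSpace X] [ConnectedSpace X]
    (hom : Continua.Homogeneous X) (hne : (Continua.nonblockers X).Nonempty) :
    ∀ x : X, Continua.minNonblocker x = Continua.blockedSet x := by
  intro a
  have hn := Continua.nonblockersAt_nonempty hom hne a
  have : Nontrivial X := by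
    obtain ⟨A, hA, ha⟩ := hn
    obtain ⟨x, hx⟩ := (ne_univ_iff_exists_notMem _).1 hA.1
    exact ⟨x, a, fun h => hx (h ▸ ha)⟩
  have hsub := Continua.blockedSet_subset_minNonblocker a
  have ha := Continua.self_mem_blockedSet a
  refine Subset.antisymm (fun x hx => ?_) hsub
  let A : Continua.Hyp X :=
    ⟨⟨Continua.blockedSet a, (Continua.isClosed_blockedSet hom hne a).isCompact⟩, ⟨a, ha⟩⟩
  exact (Continua.mem_minNonblocker_iff hn).1 hx A
    (Continua.mem_nonblockers_of_isClosed_blockedSet rfl fun h =>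
      Continua.minNonblocker_ne_univ hn (univ_subset_iff.1 (h ▸ hsub))) ha
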